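/- Let $R\subset\mathbb R^d$ be a normalized root system, i.e. a finite set of unit vectors such that $\sigma_\alpha(R)=R$ for every $\alpha\in R$, where $\sigma_\alpha(x)=x-2\langle\alpha,x\rangle\alpha$. Let $W\subset O(\mathbb R^d)$ be the finite reflection group generated by $\{\sigma_\alpha:\alpha\in R\}$, let $[g_{ij}]$ denote the matrix of $g\in W$ (so $(gx)_i=\sum_j g_{ij}x_j$), let $v\in\mathbb R^d$ satisfy $\langle\alpha,v\rangle\ne0$ for all $\alpha\in R$, and let $R_+=\{\alpha\in R:\langle\alpha,v\rangle>0\}$ and $C_+=\{x\in\mathbb R^d:\langle x,\alpha\rangle>0\ \text{for all }\alpha\in R_+\}$ be the corresponding positive roots and positive Weyl chamber. Let $\Omega\subset\mathbb R^d$ be open with $\sigma_\alpha(\Omega)=\Omega$ for all $\alpha\in R$, and put $\Omega_+=\Omega\cap C_+$. For an open set $U$, $H^1(U)$ is the space of complex-valued functions in $L^2(U)$ whose weak first-order partial derivatives exist and belong to $L^2(U)$. For a weight $\omega\colon W\to\mathbb C$, a function $\phi$ on $\Omega_+$ and a function $\Phi$ on $\Omega$, set $$\mathcal E^\omega\phi(gx)=\omega(g)\phi(x)\quad(x\in\Omega_+,\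 g\in W),\qquad \mathcal A_\omega\Phi(y)=\frac1{|W|}\sum_{g\in W}\omega(g)\Phi(gy)\quad(y\in\Omega).$$ The function $\mathcal E^\omega\phi$ is well defined on $\bigcup_{g\in W}g\Omega_+$, that is, almost everywhere on $\Omega$ (off this union it is set to be $0$). Write $\mathcal E=\mathcal E^{1}$, $\mathcal A=\mathcal A_{1}$, let $\mathcal E^{g_{ji}}$ be the extension operator with weight $g\mapsto g_{ji}$, and for a space $V$ of functions on $\Omega$ write $\mathcal A V=\{\mathcal A\Phi:\Phi\in V\}$ and $V^+=\{\Phi|_{\Omega_+}:\Phi\in V\}$. Then: (1) For every $f\in H^1(\Omega_+)$ the even extension $\mathcal Ef$ belongs to $H^1(\Omega)$ and, for $j=1,\dots,d$, $$\partial_j(\mathcal Ef)=\sum_{i=1}^d\mathcal E^{g_{ji}}(\partial_i f).$$ (2) $H^1(\Omega_+)=\big(\mathcal A H^1(\Omega)\big)^+$. -/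

import Mathlib

open MeasureTheory

noncomputable section

namespace ReflExt

/-- Euclidean space `ℝ^d`. -/
abbrev Eucl (d : ℕ) : Type := EuclideanSpace ℝ (Fin d)

/-! ### Finite reflection groups -/

/-- The orthogonal reflection `σ_α` in the hyperplane `⟨α⟩^⊥`. -/
def rootRefl {d : ℕ} (α : Eucl d) : Eucl d ≃ₗᵢ[ℝ] Eucl d :=
  (Submodule.span ℝ {α})ᗮ.reflection

theorem rootRefl_apply {d : ℕ} {α : Eucl d} (hα : ‖α‖ = 1) (x : Eucl d) :
    rootRefl α x = x - (2 * inner ℝ α x) • α := by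
  unfold rootRefl
  rw [Submodule.reflection_orthogonal_apply, Submodule.reflection_singleton_apply, hα]
  simp [two_smul, two_mul, add_smul]

/-- A normalized root system: a finite set of unit vectors with `σ_α(R) = R` for all `α ∈ R`. -/
structure IsNormalizedRootSystem {d : ℕ} (R : Set (Eucl d)) : Prop where
  finite : R.Finite
  norm_eq_one : ∀ α ∈ R, ‖α‖ = 1
  refl_image : ∀ α ∈ R, rootRefl α '' R = R

/-- The reflection group `W = W(R)`: the subgroup of `O(ℝ^d)` generated by the `σ_α`, `α ∈ R`. -/
def reflGroup {d : ℕ} (R : Set (Eucl d)) : Subgroup (Eucl d ≃ₗᵢ[ℝ] Eucl d) :=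
  Subgroup.closure (rootRefl '' R)

/-- The set `R₊` of positive roots determined by the vector `v`. -/
def posRoots {d : ℕ} (R : Set (Eucl d)) (v : Eucl d) : Set (Eucl d) :=
  {α ∈ R | 0 < inner ℝ α v}

/-- The positive Weyl chamber `C₊`. -/
def posChamber {d : ℕ} (R : Set (Eucl d)) (v : Eucl d) : Set (Eucl d) :=
  {x | ∀ α ∈ posRoots R v, 0 < inner ℝ x α}

/-- The positive part `Ω₊ = Ω ∩ C₊` of `Ω`. -/
def posRegion {d : ℕ} (R : Set (Eucl d)) (v : Eucl d) (Ω : Set (Eucl d)) : Set (Eucl d) :=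
  Ω ∩ posChamber R v

/-- `Ω` is `W`-symmetric: `σ_α(Ω) = Ω` for all `α ∈ R`. -/
def IsSymmetricSet {d : ℕ} (R : Set (Eucl d)) (Ω : Set (Eucl d)) : Prop :=
  ∀ α ∈ R, rootRefl α '' Ω = Ω

/-- The group `W` is finite, so the sums over `W` below are genuine finite sums. -/
theorem finite_reflGroup {d : ℕ} {R : Set (Eucl d)} (hR : IsNormalizedRootSystem R) :
    Finite (reflGroup R) := by
  have hmem : ∀ g ∈ reflGroup R, ∀ α ∈ R, g α ∈ R := by
    intro g hg
    induction hg using Subgroup.closure_induction'' with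
    | mem x hx =>
      obtain ⟨β, hβ, rfl⟩ := hx
      intro α hα
      rw [← hR.refl_image β hβ]
      exact ⟨α, hα, rfl⟩
    | inv_mem x hx =>
      obtain ⟨β, hβ, rfl⟩ := hx
      intro α hα
      rw [← hR.refl_image β hβ] at hα
      obtain ⟨γ, hγ, rfl⟩ := hα
      have : (rootRefl β)⁻¹ (rootRefl β γ) = γ := (rootRefl β).symm_apply_apply γ
      rwa [this]
    | one => intro α hα; exact hα
    | mul x y _ _ hx hy => intro α hα; exact hx _ (hy _ hα)
  have hfix : ∀ g ∈ reflGroup R, ∀ x, (∀ α ∈ R, inner ℝ α x = 0) → g x = x := by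
    intro g hg x hx
    induction hg using Subgroup.closure_induction with
    | mem y hy =>
      obtain ⟨β, hβ, rfl⟩ := hy
      rw [rootRefl_apply (hR.norm_eq_one β hβ), hx β hβ]
      simp
    | one => rfl
    | mul y z _ _ hy hz => change y (z x) = x; rw [hz, hy]
    | inv y _ hy => exact (y.symm_apply_eq).2 hy.symm
  have := hR.finite.to_subtype
  let F : reflGroup R → (R → R) := fun g α => ⟨g.1 α, hmem g.1 g.2 α α.2⟩
  refine Finite.of_injective F fun g h hgh => ?_
  have hEq : ∀ α ∈ R, g.1 α = h.1 α := fun α hα =>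
    congrArg Subtype.val (congrFun hgh ⟨α, hα⟩)
  apply Subtype.ext
  apply LinearIsometryEquiv.ext
  intro x
  obtain ⟨y, hy, z, hz, rfl⟩ := (Submodule.span ℝ R).exists_add_mem_mem_orthogonal x
  have hz' : ∀ α ∈ R, inner ℝ α z = 0 := fun α hα => hz α (Submodule.subset_span hα)
  rw [map_add, map_add, hfix g.1 g.2 z hz', hfix h.1 h.2 z hz']
  congr 1
  exact LinearMap.eqOn_span (f := g.1.toLinearEquiv.toLinearMap)
    (g := h.1.toLinearEquiv.toLinearMap) hEq hy

/-! ### Weighted extension and averaging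

A function on `Ω` or on `Ω₊` is represented by a function on `ℝ^d`; its values off that set play
no role. -/

/-- The weighted extension operator: the value at `g x`, for `g ∈ W` and `x ∈ Ω₊ =: Ωp`, is
`ω(g) φ(x)`. The sets `g Ω₊`, `g ∈ W`, are pairwise disjoint, so at most one term of the sum is
nonzero; off their union (a null set in `Ω`) the value is `0`. -/
def weightedExtension {d : ℕ} (R Ωp : Set (Eucl d)) (ω : reflGroup R → ℂ) (φ : Eucl d → ℂ) :
    Eucl d → ℂ :=
  fun y => ∑ᶠ g : reflGroup R, ω g * Ωp.indicator φ (g.1.symm y)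

/-- The weighted averaging operator `A_ω Φ(y) = |W|⁻¹ ∑_{g ∈ W} ω(g) Φ(g y)`. -/
def weightedAverage {d : ℕ} (R : Set (Eucl d)) (ω : reflGroup R → ℂ) (Φ : Eucl d → ℂ) : Eucl d → ℂ :=
  fun y => (Nat.card (reflGroup R) : ℂ)⁻¹ * ∑ᶠ g : reflGroup R, ω g * Φ (g.1 y)

/-- The weight `g ↦ g_{ji}`, where `[g_{ij}]` is the matrix of `g`: `(g x)_j = ∑_i g_{ji} x_i`. -/
def entryWeight {d : ℕ} (R : Set (Eucl d)) (j i : Fin d) : reflGroup R → ℂ :=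
  fun g => ((g.1 (EuclideanSpace.single i 1) j : ℝ) : ℂ)

theorem apply_eq_sum_entry {d : ℕ} {R : Set (Eucl d)} (g : reflGroup R) (x : Eucl d) (j : Fin d) :
    ((g.1 x j : ℝ) : ℂ) = ∑ i, entryWeight R j i g * (x i : ℂ) := by
  have hx : x = ∑ i, x i • EuclideanSpace.single i (1 : ℝ) := by
    ext k
    simp [Pi.single_apply]
  conv_lhs => rw [hx]
  simp [entryWeight, map_sum, mul_comm]

/-! ### The Sobolev space `H¹` -/

/-- `φ ∈ C_c^∞(U)` (complex valued, extended by zero to `ℝ^d`). -/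
def IsTestFunction {d : ℕ} (U : Set (Eucl d)) (φ : Eucl d → ℂ) : Prop :=
  ContDiff ℝ (⊤ : ℕ∞) φ ∧ HasCompactSupport φ ∧ tsupport φ ⊆ U

/-- The classical partial derivative `∂_j φ`. -/
def partialDeriv {d : ℕ} (j : Fin d) (φ : Eucl d → ℂ) (x : Eucl d) : ℂ :=
  fderiv ℝ φ x (EuclideanSpace.single j 1)

/-- `h` is the weak partial derivative `∂_j f` on the open set `U`. -/
structure HasWeakPartial {d : ℕ} (U : Set (Eucl d)) (j : Fin d) (f h : Eucl d → ℂ) : Prop where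
  locallyIntegrable : LocallyIntegrableOn f U volume
  locallyIntegrable_deriv : LocallyIntegrableOn h U volume
  integral_eq : ∀ φ, IsTestFunction U φ →
    ∫ x in U, f x * partialDeriv j φ x = - ∫ x in U, h x * φ x

/-- The Sobolev space `H¹(U)`: functions in `L²(U)` all of whose weak first order partial
derivatives exist and are in `L²(U)`. -/
def H1 {d : ℕ} (U : Set (Eucl d)) : Set (Eucl d → ℂ) :=
  {f | MemLp f 2 (volume.restrict U) ∧
    ∀ j, ∃ h, MemLp h 2 (volume.restrict U) ∧ HasWeakPartial U j f h}

/-- `V⁺ = {Φ|_{Ω₊} : Φ ∈ V}`, with `Ω₊ =: Ωp`. -/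
def restrictions {d : ℕ} (Ωp : Set (Eucl d)) (V : Set (Eucl d → ℂ)) : Set (Eucl d → ℂ) :=
  {f | ∃ Φ ∈ V, Set.EqOn f Φ Ωp}

end ReflExt

end

open ReflExt

/-! ### Root systems: the reflection group acts freely on chambers. -/

namespace ReflExt

variable {d : ℕ} {R : Set (Eucl d)} {v : Eucl d}

/-! Test the even extension of `f` against `∂_j φ` and pull every chamber back to `Ω₊`: the integral
becomes that of `f · div ψ` over `Ω₊`, where `ψ = ∑_g φ(g ·) g⁻¹e_j` is smooth with compact support
in `Ω`. This support may meet the walls, so the weak derivative of `f` does not apply directly.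
Replacing `g` by `g σ_α` shows that `⟨α, ψ⟩` is odd under `σ_α`, hence `|⟨α, ψ(x)⟩| ≤ L |⟨α, x⟩|`
(`symmetrizedField_tangential`). Multiply `ψ` by cutoffs that vanish within `1/n` of the walls:
their gradients are normal to the walls and of size `n` in strips of width of order `1/n`, so the
error stays bounded and tends to `0` by dominated convergence
(`integral_mul_divergence_of_tangential`). No trace theorem and no regularity of `∂Ω` enters.

The extension is defined as a sum over `W`, so this argument never uses disjointness of the
chambers. Disjointness gives the extension its prescribed values, hence the recovery of `f` by
averaging; it is `eq_one_of_mem_posChamber`, proved with simple roots and the exchange property. The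
equality of spaces then follows from the extension result together with the invariance of `H¹(Ω)`
under `W`. -/

theorem rootRefl_mul_self (α : Eucl d) : rootRefl α * rootRefl α = 1 := by
  exact Submodule.reflection_mul_reflection _

theorem rootRefl_self {α : Eucl d} (hα : ‖α‖ = 1) : rootRefl α α = -α := by
  rw [rootRefl_apply hα, real_inner_self_eq_norm_sq, hα]
  module

theorem rootRefl_conj (h : Eucl d ≃ₗᵢ[ℝ] Eucl d) {α : Eucl d} (hα : ‖α‖ = 1) :
    rootRefl (h α) * h = h * rootRefl α := by
  ext1 x
  change rootRefl (h α) (h x) = h (rootRefl α x)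
  rw [rootRefl_apply (by rw [h.norm_map, hα]), rootRefl_apply hα, h.inner_map_map, map_sub, map_smul]

theorem IsNormalizedRootSystem.refl_mem (hR : IsNormalizedRootSystem R) {α β : Eucl d}
    (hα : α ∈ R) (hβ : β ∈ R) : rootRefl α β ∈ R := by
  rw [← hR.refl_image α hα]
  exact ⟨β, hβ, rfl⟩

theorem IsNormalizedRootSystem.neg_mem (hR : IsNormalizedRootSystem R) {α : Eucl d}
    (hα : α ∈ R) : -α ∈ R := by
  rw [← rootRefl_self (hR.norm_eq_one α hα)]
  exact hR.refl_mem hα hα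

theorem IsNormalizedRootSystem.reflGroup_apply_mem (hR : IsNormalizedRootSystem R)
    {g : Eucl d ≃ₗᵢ[ℝ] Eucl d} (hg : g ∈ reflGroup R) : ∀ α ∈ R, g α ∈ R := by
  induction hg using Subgroup.closure_induction'' with
  | mem x hx =>
    obtain ⟨β, hβ, rfl⟩ := hx
    exact fun α hα => hR.refl_mem hβ hα
  | inv_mem x hx =>
    obtain ⟨β, hβ, rfl⟩ := hx
    rw [inv_eq_of_mul_eq_one_left (rootRefl_mul_self β)]
    exact fun α hα => hR.refl_mem hβ hα
  | one => exact fun α hα => hα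
  | mul x y _ _ hx hy => exact fun α hα => hx _ (hy _ hα)

theorem mem_or_neg_mem_posRoots (hR : IsNormalizedRootSystem R)
    (hv : ∀ α ∈ R, inner ℝ α v ≠ 0) {α : Eucl d} (hα : α ∈ R) :
    α ∈ posRoots R v ∨ -α ∈ posRoots R v := by
  rcases lt_or_gt_of_ne (hv α hα) with h | h
  · exact Or.inr ⟨hR.neg_mem hα, by rw [inner_neg_left]; linarith⟩
  · exact Or.inl ⟨hα, h⟩

/-- A system of simple roots for `R₊`: a set of positive roots, spanning `R₊` as a cone, each of
whose reflections preserves the remaining positive roots. -/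
structure IsSimpleSystem (R : Set (Eucl d)) (v : Eucl d) (S : Set (Eucl d)) : Prop where
  subset : S ⊆ posRoots R v
  subset_span : posRoots R v ⊆ Submodule.span NNReal S
  refl_mem : ∀ α ∈ S, ∀ β ∈ posRoots R v, β ≠ α → rootRefl α β ∈ posRoots R v

theorem inner_pos_or_eq_zero_of_mem_span {S : Set (Eucl d)} (hS : ∀ α ∈ S, 0 < inner ℝ α v)
    {z : Eucl d} (hz : z ∈ Submodule.span NNReal S) : 0 < inner ℝ z v ∨ z = 0 := by
  induction hz using Submodule.span_induction with
  | mem x hx => exact Or.inl (hS x hx)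
  | zero => exact Or.inr rfl
  | add x y _ _ hx hy =>
    rcases hx with hx | rfl
    · rcases hy with hy | rfl
      · left; rw [inner_add_left]; positivity
      · left; simpa using hx
    · simpa using hy
  | smul c x _ hx =>
    rcases hx with hx | rfl
    · rcases eq_or_ne c 0 with rfl | hc
      · right; simp
      · left
        rw [NNReal.smul_def, real_inner_smul_left]
        have : 0 < (c : ℝ) := by positivity
        positivity
    · right; simp

/-- Take `S` minimal among the subsets of `R₊` generating its cone. If `σ_α β` were negative, adding
the cone expansions of `β` and `-σ_α β` and collecting the `α` terms gives `z + w = c α` with `z`,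
`w` in the cone of `S \ {α}`. For `c > 0` this contradicts minimality; for `c ≤ 0`, pairing with `v`
forces `z = 0`, so `β = α`. -/
theorem exists_isSimpleSystem (hR : IsNormalizedRootSystem R)
    (hv : ∀ α ∈ R, inner ℝ α v ≠ 0) : ∃ S, IsSimpleSystem R v S := by
  have hfin : (posRoots R v).Finite := hR.finite.subset fun α hα => hα.1
  have hfin' : {S | S ⊆ posRoots R v ∧ posRoots R v ⊆ Submodule.span NNReal S}.Finite :=
    hfin.finite_subsets.subset fun S hS => hS.1
  obtain ⟨S, hS⟩ := hfin'.exists_minimal ⟨_, subset_rfl, Submodule.subset_span⟩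
  refine ⟨S, hS.prop.1, hS.prop.2, fun α hα β hβ hne => ?_⟩
  have hαR := (hS.prop.1 hα).1
  set T := S \ {α} with hT
  have hST : S = insert α T := by rw [hT, Set.insert_sdiff_singleton, Set.insert_eq_of_mem hα]
  have hTpos : ∀ γ ∈ T, 0 < inner ℝ γ v := fun γ hγ => (hS.prop.1 hγ.1).2
  have hαT : α ∉ Submodule.span NNReal T := fun hmem => by
    have hle : Submodule.span NNReal S ≤ Submodule.span NNReal T := by
      rw [Submodule.span_le, hST, Set.insert_subset_iff]
      exact ⟨hmem, Submodule.subset_span⟩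
    have := hS.le_of_le ⟨Set.sdiff_subset.trans hS.prop.1, hS.prop.2.trans hle⟩ Set.sdiff_subset hα
    exact this.2 rfl
  refine (mem_or_neg_mem_posRoots hR hv (hR.refl_mem hαR hβ.1)).resolve_right fun hneg => ?_
  have h1 := hS.prop.2 hβ
  have h2 := hS.prop.2 hneg
  rw [hST, SetLike.mem_coe, Submodule.mem_span_insert] at h1 h2
  obtain ⟨b, z, hz, hbz⟩ := h1
  obtain ⟨e, w, hw, hew⟩ := h2
  rw [rootRefl_apply (hR.norm_eq_one α hαR)] at hew
  rw [NNReal.smul_def] at hbz hew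
  set c : ℝ := 2 * inner ℝ α β - b - e with hc
  have hzw : z + w = c • α := by
    have : z + w = (b • α + z) + (e • α + w) - (b • α + e • α) := by abel
    rw [this, NNReal.smul_def, NNReal.smul_def, ← hbz, ← hew, hc]
    module
  rcases lt_or_ge 0 c with hpos | hle
  · apply hαT
    have : α = (⟨c⁻¹, (inv_pos.2 hpos).le⟩ : NNReal) • (z + w) := by
      change α = c⁻¹ • (z + w)
      rw [hzw, smul_smul, inv_mul_cancel₀ hpos.ne', one_smul]
    rw [this]
    exact Submodule.smul_mem _ _ (Submodule.add_mem _ hz hw)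
  · have hin : inner ℝ z v + inner ℝ w v = c * inner ℝ α v := by
      rw [← inner_add_left, hzw, real_inner_smul_left]
    have hcv := mul_nonpos_of_nonpos_of_nonneg hle (hS.prop.1 hα).2.le
    have hw0 : 0 ≤ inner ℝ w v := by
      rcases inner_pos_or_eq_zero_of_mem_span hTpos hw with h | h
      · exact h.le
      · simp [h]
    rcases inner_pos_or_eq_zero_of_mem_span hTpos hz with h | h
    · linarith
    · rw [h, add_zero] at hbz
      have hnorm := hR.norm_eq_one β hβ.1
      rw [hbz, norm_smul, hR.norm_eq_one α hαR, mul_one] at hnorm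
      have hb : (b : ℝ) = 1 := by simpa using hnorm
      exact hne (by rw [hbz, hb, one_smul])

namespace IsSimpleSystem

variable {S : Set (Eucl d)}

/-- Every positive root is conjugate to a simple root under the simple reflections. -/
theorem exists_conj (hS : IsSimpleSystem R v S) (hR : IsNormalizedRootSystem R) {β : Eucl d}
    (hβ : β ∈ posRoots R v) :
    ∃ h ∈ Subgroup.closure (rootRefl '' S), h β ∈ S := by
  set O : Set (Eucl d) := {γ ∈ posRoots R v | ∃ h ∈ Subgroup.closure (rootRefl '' S), h β = γ}
  have hO : O.Finite := hR.finite.subset fun γ hγ => hγ.1.1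
  -- A positive root of least height `⟨γ, v⟩` in the orbit is simple. Otherwise a simple reflection
  -- with `⟨γ, α⟩ > 0` would lower the height, and if there is none then `γ` pairs nonpositively
  -- with its own cone, hence with itself.
  obtain ⟨γ, ⟨hγ, h, hh, rfl⟩, hmin⟩ :=
    Set.exists_min_image O (fun γ => inner ℝ γ v) hO ⟨β, hβ, 1, one_mem _, rfl⟩
  refine ⟨h, hh, ?_⟩
  by_contra hnot
  have key : ∀ α ∈ S, inner ℝ (h β) α ≤ 0 := by
    intro α hα
    by_contra! hpos
    have hαpos := hS.subset hα
    have hmem := hS.refl_mem α hα _ hγ (fun h' => hnot (h' ▸ hα))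
    have := hmin _ ⟨hmem, rootRefl α * h,
      mul_mem (Subgroup.subset_closure ⟨α, hα, rfl⟩) hh, rfl⟩
    rw [rootRefl_apply (hR.norm_eq_one α hαpos.1), inner_sub_left, real_inner_smul_left,
      real_inner_comm (h β) α] at this
    have h2 := mul_pos hpos hαpos.2
    linarith
  have hall : ∀ z ∈ Submodule.span NNReal S, inner ℝ (h β) z ≤ 0 := by
    intro z hz
    induction hz using Submodule.span_induction with
    | mem x hx => exact key x hx
    | zero => simp
    | add x y _ _ hx hy => rw [inner_add_right]; linarith
    | smul c x _ hx =>
      rw [NNReal.smul_def, real_inner_smul_right]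
      exact mul_nonpos_of_nonneg_of_nonpos c.2 hx
  have := hall _ (hS.subset_span hγ)
  rw [real_inner_self_eq_norm_sq, hR.norm_eq_one _ hγ.1] at this
  norm_num at this

/-- If `h β` is simple, then `σ_β = h⁻¹ σ_{hβ} h`; and `σ_{-β} = σ_β` covers the negative roots. -/
theorem reflGroup_le (hS : IsSimpleSystem R v S) (hR : IsNormalizedRootSystem R)
    (hv : ∀ α ∈ R, inner ℝ α v ≠ 0) :
    reflGroup R ≤ Subgroup.closure (rootRefl '' S) := by
  have hpos : ∀ β ∈ posRoots R v, rootRefl β ∈ Subgroup.closure (rootRefl '' S) := by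
    intro β hβ
    obtain ⟨h, hh, hmem⟩ := hS.exists_conj hR hβ
    have hc := rootRefl_conj h (hR.norm_eq_one β hβ.1)
    have : rootRefl β = h⁻¹ * rootRefl (h β) * h := by rw [mul_assoc, hc, inv_mul_cancel_left]
    rw [this]
    exact mul_mem (mul_mem (inv_mem hh) (Subgroup.subset_closure ⟨_, hmem, rfl⟩)) hh
  rw [reflGroup, Subgroup.closure_le]
  rintro _ ⟨β, hβ, rfl⟩
  rcases mem_or_neg_mem_posRoots hR hv hβ with h | h
  · exact hpos β h
  · have : rootRefl β = rootRefl (-β) := by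
      unfold rootRefl
      congr 2
      rw [← Set.neg_singleton, Submodule.span_neg]
    rw [this]
    exact hpos _ h

theorem exists_list (hS : IsSimpleSystem R v S) (hR : IsNormalizedRootSystem R)
    (hv : ∀ α ∈ R, inner ℝ α v ≠ 0) {g : Eucl d ≃ₗᵢ[ℝ] Eucl d} (hg : g ∈ reflGroup R) :
    ∃ l : List (Eucl d), (∀ α ∈ l, α ∈ S) ∧ (l.map rootRefl).prod = g := by
  have hg' := hS.reflGroup_le hR hv hg
  induction hg' using Subgroup.closure_induction'' with
  | mem x hx =>
    obtain ⟨α, hα, rfl⟩ := hx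
    exact ⟨[α], by simpa using hα, by simp⟩
  | inv_mem x hx =>
    obtain ⟨α, hα, rfl⟩ := hx
    exact ⟨[α], by simpa using hα, by
      simpa using (inv_eq_of_mul_eq_one_left (rootRefl_mul_self α)).symm⟩
  | one => exact ⟨[], by simp, by simp⟩
  | mul x y hx hy ihx ihy =>
    have hle : Subgroup.closure (rootRefl '' S) ≤ reflGroup R :=
      Subgroup.closure_mono (Set.image_mono (hS.subset.trans fun α hα => hα.1))
    obtain ⟨l, hl, rfl⟩ := ihx (hle hx)
    obtain ⟨m, hm, rfl⟩ := ihy (hle hy)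
    refine ⟨l ++ m, fun α hα => ?_, by simp⟩
    rcases List.mem_append.1 hα with h | h
    exacts [hl _ h, hm _ h]

/-- The exchange property. -/
theorem exchange (hS : IsSimpleSystem R v S) (hR : IsNormalizedRootSystem R) {α : Eucl d}
    (hα : α ∈ posRoots R v) (m : List (Eucl d)) (hm : ∀ γ ∈ m, γ ∈ S)
    (hneg : (m.map rootRefl).prod α ∉ posRoots R v) :
    ∃ m' : List (Eucl d), (∀ γ ∈ m', γ ∈ S) ∧ m'.length < m.length ∧
      (m.map rootRefl).prod * rootRefl α = (m'.map rootRefl).prod := by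
  induction m with
  | nil => exact absurd hα hneg
  | cons s m ih =>
    have hm' : ∀ γ ∈ m, γ ∈ S := fun γ hγ => hm γ (List.mem_cons_of_mem _ hγ)
    have hs : s ∈ S := hm s List.mem_cons_self
    rw [List.map_cons, List.prod_cons] at hneg ⊢
    set h := (m.map rootRefl).prod with hh
    -- If `s` is the letter at which the image of `α` first turns negative, then `h α = s`, so `σ_s
    -- h σ_α = h` and the letter `s` is deleted.
    by_cases hcase : h α ∈ posRoots R v
    · have hsα : h α = s := by
        by_contra hne
        exact hneg (hS.refl_mem s hs _ hcase hne)
      refine ⟨m, hm', by simp, ?_⟩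
      rw [mul_assoc, ← rootRefl_conj h (hR.norm_eq_one α hα.1), hsα, ← mul_assoc,
        rootRefl_mul_self, one_mul]
    · obtain ⟨m', hmS, hlen, heq⟩ := ih hm' hcase
      refine ⟨s :: m', ?_, by simpa using hlen, ?_⟩
      · intro γ hγ
        rcases List.mem_cons.1 hγ with rfl | h
        exacts [hs, hmS _ h]
      · rw [mul_assoc, heq, List.map_cons, List.prod_cons]

/-- If the word ends in `α`, its prefix must send `α` to a negative root, because the whole word
keeps `α` positive. The exchange property then yields a shorter word for the same element. -/
theorem list_prod_eq_one (hS : IsSimpleSystem R v S) (hR : IsNormalizedRootSystem R)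
    (l : List (Eucl d)) (hl : ∀ γ ∈ l, γ ∈ S)
    (hpos : ∀ α ∈ posRoots R v, (l.map rootRefl).prod α ∈ posRoots R v) :
    (l.map rootRefl).prod = 1 := by
  induction hn : l.length using Nat.strong_induction_on generalizing l with
  | _ n ih =>
    subst hn
    rcases List.eq_nil_or_concat' l with rfl | ⟨m, α, rfl⟩
    · simp
    · have hm : ∀ γ ∈ m, γ ∈ S := fun γ hγ => hl γ (by simp [hγ])
      have hα : α ∈ S := hl α (by simp)
      have hprod : ((m ++ [α]).map rootRefl).prod = (m.map rootRefl).prod * rootRefl α := by simp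
      rw [hprod] at hpos ⊢
      have hαpos := hS.subset hα
      have hneg : (m.map rootRefl).prod α ∉ posRoots R v := by
        intro hmem
        have h1 := (hpos α hαpos).2
        have h2 : ((m.map rootRefl).prod * rootRefl α) α = -(m.map rootRefl).prod α := by
          change (m.map rootRefl).prod (rootRefl α α) = _
          rw [rootRefl_self (hR.norm_eq_one α hαpos.1), map_neg]
        rw [h2, inner_neg_left] at h1
        linarith [hmem.2]
      obtain ⟨m', hmS, hlen, heq⟩ := hS.exchange hR hαpos m hm hneg
      rw [heq] at hpos ⊢
      exact ih _ (by simp; omega) m' hmS hpos rfl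

end IsSimpleSystem

/-- The reflection group acts freely on chambers. -/
theorem eq_one_of_mem_posChamber (hR : IsNormalizedRootSystem R)
    (hv : ∀ α ∈ R, inner ℝ α v ≠ 0) {g : Eucl d ≃ₗᵢ[ℝ] Eucl d} (hg : g ∈ reflGroup R)
    {x : Eucl d} (hx : x ∈ posChamber R v) (hgx : g x ∈ posChamber R v) : g = 1 := by
  obtain ⟨S, hS⟩ := exists_isSimpleSystem hR hv
  obtain ⟨l, hl, rfl⟩ := hS.exists_list hR hv hg
  refine hS.list_prod_eq_one hR l hl fun α hα => ?_
  -- If `-g α` were positive, then `⟨g x, -g α⟩ = -⟨x, α⟩` would be both positive and negative.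
  refine (mem_or_neg_mem_posRoots hR hv (hR.reflGroup_apply_mem hg α hα.1)).resolve_right
    fun hneg => ?_
  have h1 := hgx _ hneg
  have h2 := hx α hα
  rw [inner_neg_right, LinearIsometryEquiv.inner_map_map] at h1
  linarith

theorem weightedExtension_apply (hR : IsNormalizedRootSystem R)
    (hv : ∀ α ∈ R, inner ℝ α v ≠ 0) (Ω : Set (Eucl d)) (ω : reflGroup R → ℂ) (φ : Eucl d → ℂ)
    (g : reflGroup R) {x : Eucl d} (hx : x ∈ posRegion R v Ω) :
    weightedExtension R (posRegion R v Ω) ω φ (g.1 x) = ω g * φ x := by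
  unfold weightedExtension
  rw [finsum_eq_single _ g]
  · rw [LinearIsometryEquiv.symm_apply_apply, Set.indicator_of_mem hx]
  · intro h hne
    rw [Set.indicator_of_notMem, mul_zero]
    intro hmem
    have hmem' : (h⁻¹ * g).1 x ∈ posChamber R v := hmem.2
    have := eq_one_of_mem_posChamber hR hv (h⁻¹ * g).2 hx.2 hmem'
    exact hne (inv_mul_eq_one.1 (Subtype.ext this))

end ReflExt

/-! ### Test functions and their behaviour under isometries. -/

namespace ReflExt

variable {d : ℕ} {U : Set (Eucl d)}

theorem locallyIntegrableOn_of_memLp {f : Eucl d → ℂ} (hf : MemLp f 2 (volume.restrict U)) :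
    LocallyIntegrableOn f U volume :=
  locallyIntegrableOn_of_locallyIntegrable_restrict
    (MeasureTheory.MemLp.locallyIntegrable hf one_le_two)

theorem integrable_mul_of_hasCompactSupport {f u : Eucl d → ℂ}
    (hf : MemLp f 2 (volume.restrict U)) (hu : Continuous u) (hc : HasCompactSupport u) :
    Integrable (fun x => f x * u x) (volume.restrict U) :=
  hf.integrable_mul (q := 2) (hu.memLp_of_hasCompactSupport hc)

namespace IsTestFunction

variable {φ : Eucl d → ℂ}

theorem continuous (h : IsTestFunction U φ) : Continuous φ := h.1.continuous

theorem differentiable (h : IsTestFunction U φ) : Differentiable ℝ φ :=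
  h.1.differentiable (by simp)

theorem mono {V : Set (Eucl d)} (h : IsTestFunction U φ) (hUV : U ⊆ V) : IsTestFunction V φ :=
  ⟨h.1, h.2.1, h.2.2.trans hUV⟩

theorem eq_zero_of_notMem (h : IsTestFunction U φ) {x : Eucl d} (hx : x ∉ U) : φ x = 0 :=
  image_eq_zero_of_notMem_tsupport fun h' => hx (h.2.2 h')

theorem partialDeriv (h : IsTestFunction U φ) (j : Fin d) :
    IsTestFunction U (ReflExt.partialDeriv j φ) := by
  have hsub : tsupport (ReflExt.partialDeriv j φ) ⊆ tsupport φ := by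
    refine (closure_mono fun x hx => ?_).trans (tsupport_fderiv_subset ℝ (f := φ))
    rw [Function.mem_support] at hx ⊢
    intro h0
    exact hx (by simp [ReflExt.partialDeriv, h0])
  refine ⟨?_, h.2.1.of_isClosed_subset (isClosed_tsupport _) hsub, hsub.trans h.2.2⟩
  unfold ReflExt.partialDeriv
  exact (h.1.fderiv_right (m := (⊤ : ℕ∞)) (by norm_cast)).clm_apply contDiff_const

theorem const_mul (h : IsTestFunction U φ) (c : ℂ) : IsTestFunction U fun x => c * φ x := by
  have hsub : tsupport (fun x => c * φ x) ⊆ tsupport φ :=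
    tsupport_mul_subset_right (f := fun _ => c)
  exact ⟨contDiff_const.mul h.1, h.2.1.of_isClosed_subset (isClosed_tsupport _) hsub,
    hsub.trans h.2.2⟩

theorem sum {ι : Type*} (s : Finset ι) {φ : ι → Eucl d → ℂ}
    (h : ∀ i ∈ s, IsTestFunction U (φ i)) : IsTestFunction U fun x => ∑ i ∈ s, φ i x := by
  classical
  induction s using Finset.induction_on with
  | empty =>
    simp only [Finset.sum_empty]
    exact ⟨contDiff_const, HasCompactSupport.zero, by simp [tsupport]⟩
  | insert a s ha ih =>
    have h1 := h a (Finset.mem_insert_self _ _)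
    have h2 := ih fun i hi => h i (Finset.mem_insert_of_mem hi)
    simp only [Finset.sum_insert ha]
    refine ⟨h1.1.add h2.1, h1.2.1.add h2.2.1, ?_⟩
    exact (tsupport_add _ _).trans (Set.union_subset h1.2.2 h2.2.2)

theorem comp_isometry (h : IsTestFunction U φ) (g : Eucl d ≃ₗᵢ[ℝ] Eucl d)
    (hg : g ⁻¹' U ⊆ U) : IsTestFunction U fun x => φ (g x) := by
  refine ⟨h.1.comp g.contDiff, h.2.1.comp_homeomorph g.toHomeomorph, ?_⟩
  refine (tsupport_comp_subset_preimage φ g.continuous).trans ?_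
  exact (Set.preimage_mono h.2.2).trans hg

end IsTestFunction

theorem partialDeriv_comp_isometry {φ : Eucl d → ℂ} (hφ : Differentiable ℝ φ)
    (g : Eucl d ≃ₗᵢ[ℝ] Eucl d) (j : Fin d) (x : Eucl d) :
    partialDeriv j (fun y => φ (g y)) x = fderiv ℝ φ (g x) (g (EuclideanSpace.single j 1)) := by
  unfold partialDeriv
  have h : HasFDerivAt (fun y => φ (g y))
      ((fderiv ℝ φ (g x)).comp (g.toContinuousLinearEquiv : Eucl d →L[ℝ] Eucl d)) x :=
    (hφ (g x)).hasFDerivAt.comp x g.toContinuousLinearEquiv.hasFDerivAt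
  rw [h.fderiv]
  rfl

/-! ### A smooth cutoff away from finitely many hyperplanes -/

theorem deriv_smoothTransition_eq_zero {t : ℝ} (ht : t ∉ Set.Icc (0 : ℝ) 1) :
    deriv Real.smoothTransition t = 0 := by
  have h : Real.smoothTransition =ᶠ[nhds t] fun _ => Real.smoothTransition t := by
    rcases lt_or_ge t 0 with h0 | h0
    · filter_upwards [Iio_mem_nhds h0] with s hs
      rw [Real.smoothTransition.zero_of_nonpos (le_of_lt hs),
        Real.smoothTransition.zero_of_nonpos h0.le]
    · have h1 : 1 < t := by
        by_contra! h1
        exact ht ⟨h0, h1⟩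
      filter_upwards [Ioi_mem_nhds h1] with s hs
      rw [Real.smoothTransition.one_of_one_le (le_of_lt hs),
        Real.smoothTransition.one_of_one_le h1.le]
  rw [h.deriv_eq, deriv_const]

/-- Used with `s = n ⟨α, x⟩`: a factor `⟨α, x⟩` absorbs the growth `n` of the cutoff gradient,
uniformly in `n`. -/
theorem exists_bound_deriv_smoothTransition_mul :
    ∃ M : ℝ, ∀ s : ℝ, |deriv Real.smoothTransition (s - 1) * s| ≤ M := by
  have hcont : Continuous fun s : ℝ => deriv Real.smoothTransition (s - 1) * s := by
    have := (Real.smoothTransition.contDiff (n := 1)).continuous_deriv le_rfl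
    fun_prop
  have hsupp : HasCompactSupport fun s : ℝ => deriv Real.smoothTransition (s - 1) * s := by
    refine HasCompactSupport.intro (isCompact_Icc (a := 1) (b := 2)) fun s hs => ?_
    rw [deriv_smoothTransition_eq_zero, zero_mul]
    rintro ⟨h0, h1⟩
    exact hs ⟨by linarith, by linarith⟩
  exact hsupp.exists_bound_of_continuous hcont

/-- A smooth function vanishing near the hyperplanes `α^⊥`, `α ∈ A`, and equal to `1` where
`⟨α, x⟩ ≥ 2 / n` for all `α ∈ A`. -/
noncomputable def wallCutoff (A : Finset (Eucl d)) (n : ℕ) (x : Eucl d) : ℝ :=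
  ∏ α ∈ A, Real.smoothTransition (n * inner ℝ α x - 1)

variable (A : Finset (Eucl d)) (n : ℕ)

theorem contDiff_wallCutoff : ContDiff ℝ (⊤ : ℕ∞) (wallCutoff A n) := by
  unfold wallCutoff
  refine contDiff_prod fun α _ => Real.smoothTransition.contDiff.comp ?_
  exact (contDiff_const.mul (innerSL ℝ α).contDiff).sub contDiff_const

theorem wallCutoff_nonneg (x : Eucl d) : 0 ≤ wallCutoff A n x :=
  Finset.prod_nonneg fun _ _ => Real.smoothTransition.nonneg _

theorem wallCutoff_le_one (x : Eucl d) : wallCutoff A n x ≤ 1 :=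
  Finset.prod_le_one (fun _ _ => Real.smoothTransition.nonneg _)
    fun _ _ => Real.smoothTransition.le_one _

theorem tsupport_wallCutoff_subset :
    tsupport (wallCutoff A n) ⊆ {x | ∀ α ∈ A, 0 < inner ℝ α x} := by
  -- The shift by `-1` in the cutoff keeps the support in a closed set strictly inside the
  -- half-spaces.
  have h : tsupport (wallCutoff A n) ⊆ {x | ∀ α ∈ A, 1 ≤ n * inner ℝ α x} := by
    refine closure_minimal (fun x hx α hα => ?_) ?_
    · by_contra! hlt
      refine hx (Finset.prod_eq_zero hα ?_)
      exact Real.smoothTransition.zero_of_nonpos (by linarith)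
    · simp only [Set.ofPred_forall]
      exact isClosed_biInter fun α _ => isClosed_le continuous_const (by fun_prop)
  refine h.trans fun x hx α hα => ?_
  by_contra! hle
  have := mul_nonpos_of_nonneg_of_nonpos (Nat.cast_nonneg (α := ℝ) n) hle
  linarith [hx α hα]

theorem fderiv_wallCutoff [DecidableEq (Eucl d)] (x e : Eucl d) :
    fderiv ℝ (wallCutoff A n) x e =
      ∑ α ∈ A, (∏ β ∈ A.erase α, Real.smoothTransition (n * inner ℝ β x - 1)) *
        (deriv Real.smoothTransition (n * inner ℝ α x - 1) * n * inner ℝ α e) := by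
  have hfac : ∀ α ∈ A, HasFDerivAt (fun y : Eucl d => Real.smoothTransition (n * inner ℝ α y - 1))
      (deriv Real.smoothTransition (n * inner ℝ α x - 1) • ((n : ℝ) • innerSL ℝ α)) x := by
    intro α _
    have h1 : HasFDerivAt (fun y : Eucl d => (n : ℝ) * inner ℝ α y - 1)
        ((n : ℝ) • innerSL ℝ α) x :=
      (((innerSL ℝ α).hasFDerivAt (x := x)).const_mul (n : ℝ)).sub_const 1
    have h2 : HasDerivAt Real.smoothTransition
        (deriv Real.smoothTransition (n * inner ℝ α x - 1)) (n * inner ℝ α x - 1) :=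
      ((Real.smoothTransition.contDiff (n := 1)).differentiable (by simp) _).hasDerivAt
    exact h2.comp_hasFDerivAt x h1
  have h := HasFDerivAt.finsetProd hfac
  have heq : wallCutoff A n =
      fun y => ∏ α ∈ A, Real.smoothTransition (n * inner ℝ α y - 1) := rfl
  rw [heq, h.fderiv]
  simp [mul_assoc]

variable {A} in
theorem eventually_two_lt {x : Eucl d} (hx : ∀ α ∈ A, 0 < inner ℝ α x) :
    ∀ᶠ n : ℕ in Filter.atTop, ∀ α ∈ A, 2 < n * inner ℝ α x := by
  rw [Filter.eventually_all_finset]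
  intro α hα
  exact (tendsto_natCast_atTop_atTop.atTop_mul_const (hx α hα)).eventually_gt_atTop 2

/-! ### Integration by parts against fields tangential to the walls -/

variable {A n}

theorem norm_deriv_cutoff_term_le {M L : ℝ}
    (hM : ∀ s : ℝ, |deriv Real.smoothTransition (s - 1) * s| ≤ M) {p t : ℝ} {z : ℂ}
    (hp0 : 0 ≤ p) (hp1 : p ≤ 1) (hz : ‖z‖ ≤ L * |t|) (hL : 0 ≤ L) :
    ‖((p * (deriv Real.smoothTransition (n * t - 1) * n) : ℝ) : ℂ) * z‖ ≤ M * L := by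
  rw [norm_mul, Complex.norm_real, Real.norm_eq_abs, abs_mul, abs_of_nonneg hp0]
  calc p * |deriv Real.smoothTransition (n * t - 1) * n| * ‖z‖
      ≤ 1 * |deriv Real.smoothTransition (n * t - 1) * n| * (L * |t|) := by gcongr
    _ = |deriv Real.smoothTransition (n * t - 1) * (n * t)| * L := by
      rw [← mul_assoc (deriv _ _), abs_mul _ t]; ring
    _ ≤ M * L := by gcongr; exact hM _

/-- The product rule with the gradient of the cutoff grouped by walls: only the normal components
`⟨α, ψ⟩` of the field enter the error. -/
theorem sum_partialDeriv_wallCutoff_mul [DecidableEq (Eucl d)] {ψ : Fin d → Eucl d → ℂ}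
    (hψ : ∀ i, Differentiable ℝ (ψ i)) (x : Eucl d) :
    ∑ i, partialDeriv i (fun y => (wallCutoff A n y : ℂ) * ψ i y) x =
      (wallCutoff A n x : ℂ) * ∑ i, partialDeriv i (ψ i) x +
      ∑ α ∈ A, (((∏ β ∈ A.erase α, Real.smoothTransition (n * inner ℝ β x - 1)) *
        (deriv Real.smoothTransition (n * inner ℝ α x - 1) * n) : ℝ) : ℂ) *
          ∑ i, (α i : ℂ) * ψ i x := by
  have hχ : DifferentiableAt ℝ (wallCutoff A n) x :=
    (contDiff_wallCutoff A n).differentiable (by simp) x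
  have key : ∀ i, partialDeriv i (fun y => (wallCutoff A n y : ℂ) * ψ i y) x =
      (wallCutoff A n x : ℂ) * partialDeriv i (ψ i) x +
        ((fderiv ℝ (wallCutoff A n) x (EuclideanSpace.single i 1) : ℝ) : ℂ) * ψ i x := by
    intro i
    have h := hχ.hasFDerivAt.smul (hψ i x).hasFDerivAt
    have heq : (fun y => (wallCutoff A n y : ℂ) * ψ i y) = wallCutoff A n • ψ i := by
      ext y
      exact (Complex.real_smul ..).symm
    unfold partialDeriv
    rw [heq]
    have h' := congrArg (fun T => T (EuclideanSpace.single i (1 : ℝ))) h.fderiv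
    simpa using h'
  simp_rw [key, Finset.sum_add_distrib, ← Finset.mul_sum, fderiv_wallCutoff]
  congr 1
  simp_rw [Complex.ofReal_sum, Finset.sum_mul, Finset.mul_sum]
  rw [Finset.sum_comm]
  refine Finset.sum_congr rfl fun α _ => Finset.sum_congr rfl fun i _ => ?_
  have : inner ℝ α (EuclideanSpace.single i (1 : ℝ)) = α i := by
    simp [EuclideanSpace.inner_single_right]
  rw [this]
  push_cast
  ring

theorem isTestFunction_wallCutoff_mul {Ω : Set (Eucl d)} {ψ : Eucl d → ℂ}
    (hψ : IsTestFunction Ω ψ) :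
    IsTestFunction (Ω ∩ {x | ∀ α ∈ A, 0 < inner ℝ α x})
      fun y => (wallCutoff A n y : ℂ) * ψ y := by
  refine ⟨(Complex.ofRealCLM.contDiff.comp (contDiff_wallCutoff A n)).mul hψ.1,
    hψ.2.1.mul_left, Set.subset_inter (tsupport_mul_subset_right.trans hψ.2.2) ?_⟩
  refine (tsupport_mul_subset_left).trans ((closure_mono fun x hx => ?_).trans
    (tsupport_wallCutoff_subset A n))
  rw [Function.mem_support] at hx ⊢
  exact fun h => hx (by rw [h, Complex.ofReal_zero])

/-- Integration by parts on the intersection of `Ω` with the half-spaces `⟨α, x⟩ > 0`, `α ∈ A`,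
against a smooth field with compact support in `Ω` that is tangential to the walls. -/
theorem integral_mul_divergence_of_tangential {Ω Ωp : Set (Eucl d)} (hΩ : IsOpen Ω)
    (hΩp : Ωp = Ω ∩ {x | ∀ α ∈ A, 0 < inner ℝ α x})
    {f : Eucl d → ℂ} {f' : Fin d → Eucl d → ℂ} (hf : MemLp f 2 (volume.restrict Ωp))
    (hf' : ∀ i, MemLp (f' i) 2 (volume.restrict Ωp)) (hw : ∀ i, HasWeakPartial Ωp i f (f' i))
    {ψ : Fin d → Eucl d → ℂ} (hψ : ∀ i, IsTestFunction Ω (ψ i))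
    (htan : ∀ α ∈ A, ∃ L : ℝ, 0 ≤ L ∧ ∀ x, ‖∑ i, (α i : ℂ) * ψ i x‖ ≤ L * |inner ℝ α x|) :
    ∫ x in Ωp, f x * ∑ i, partialDeriv i (ψ i) x = - ∫ x in Ωp, ∑ i, f' i x * ψ i x := by
  classical
  have hΩpo : IsOpen Ωp := by
    rw [hΩp]
    refine hΩ.inter ?_
    simp only [Set.ofPred_forall]
    exact isOpen_biInter_finset fun α _ => isOpen_lt continuous_const (by fun_prop)
  obtain ⟨M, hM⟩ := exists_bound_deriv_smoothTransition_mul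
  choose! L hL0 hL using htan
  have htest : ∀ n i, IsTestFunction Ωp fun y => (wallCutoff A n y : ℂ) * ψ i y := fun n i => by
    rw [hΩp]; exact isTestFunction_wallCutoff_mul (hψ i)
  have hident : ∀ n : ℕ,
      ∫ x in Ωp, f x * ∑ i, partialDeriv i (fun y => (wallCutoff A n y : ℂ) * ψ i y) x =
      - ∫ x in Ωp, ∑ i, f' i x * ((wallCutoff A n x : ℂ) * ψ i x) := by
    intro n
    simp_rw [Finset.mul_sum]
    rw [integral_finsetSum _ fun i _ => integrable_mul_of_hasCompactSupport hf
        ((htest n i).partialDeriv i).continuous ((htest n i).partialDeriv i).2.1,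
      integral_finsetSum _ fun i _ => integrable_mul_of_hasCompactSupport (hf' i)
        (htest n i).continuous (htest n i).2.1, ← Finset.sum_neg_distrib]
    exact Finset.sum_congr rfl fun i _ => (hw i).integral_eq _ (htest n i)
  have hpos : ∀ᵐ x ∂volume.restrict Ωp, ∀ α ∈ A, 0 < inner ℝ α x := by
    filter_upwards [ae_restrict_mem hΩpo.measurableSet] with x hx
    rw [hΩp] at hx
    exact hx.2
  have hone : ∀ {n : ℕ} {x : Eucl d}, (∀ α ∈ A, 2 < n * inner ℝ α x) → wallCutoff A n x = 1 :=
    fun h => Finset.prod_eq_one fun α hα =>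
      Real.smoothTransition.one_of_one_le (by linarith [h α hα])
  set K : Set (Eucl d) := ⋃ i, tsupport (ψ i)
  have hKc : IsCompact K := isCompact_iUnion fun i => (hψ i).2.1
  have hKψ : ∀ x ∉ K, ∀ i, ψ i x = 0 := fun x hx i =>
    image_eq_zero_of_notMem_tsupport fun h => hx (Set.mem_iUnion.2 ⟨i, h⟩)
  -- A bound for the cutoff error that is independent of `n`. Since the error is supported in `K`,
  -- the dominating function `C |f|` on `K` is integrable.
  set C : ℝ := ∑ α ∈ A, M * L α
  have hdiv : IsTestFunction Ω fun x => ∑ i, partialDeriv i (ψ i) x :=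
    IsTestFunction.sum _ fun i _ => (hψ i).partialDeriv i
  have hlim1 : Filter.Tendsto (fun n : ℕ =>
      ∫ x in Ωp, f x * ∑ i, partialDeriv i (fun y => (wallCutoff A n y : ℂ) * ψ i y) x)
      Filter.atTop (nhds (∫ x in Ωp, f x * ∑ i, partialDeriv i (ψ i) x)) := by
    refine tendsto_integral_of_dominated_convergence
      (fun x => ‖f x * ∑ i, partialDeriv i (ψ i) x‖ + ‖f x * K.indicator (fun _ => (C : ℂ)) x‖)
      (fun n => ?_) ?_ (fun n => ?_) ?_
    · exact (integrable_mul_of_hasCompactSupport hf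
        (IsTestFunction.sum _ fun i _ => (htest n i).partialDeriv i).continuous
        (IsTestFunction.sum _ fun i _ => (htest n i).partialDeriv i).2.1).aestronglyMeasurable
    · refine (integrable_mul_of_hasCompactSupport hf hdiv.continuous hdiv.2.1).norm.add ?_
      refine (hf.integrable_mul (memLp_indicator_const 2 hKc.measurableSet _ (Or.inr ?_))).norm
      exact ((Measure.restrict_apply_le _ _).trans_lt hKc.measure_lt_top).ne
    · refine Filter.Eventually.of_forall fun x => ?_
      rw [sum_partialDeriv_wallCutoff_mul fun i => (hψ i).differentiable, mul_add]
      refine (norm_add_le _ _).trans (add_le_add ?_ ?_)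
      · rw [norm_mul, norm_mul, norm_mul, Complex.norm_real,
          Real.norm_of_nonneg (wallCutoff_nonneg A n x)]
        gcongr
        exact mul_le_of_le_one_left (norm_nonneg _) (wallCutoff_le_one A n x)
      · rw [norm_mul, norm_mul]
        gcongr
        by_cases hx : x ∈ K
        · rw [Set.indicator_of_mem hx, Complex.norm_real]
          refine (norm_sum_le _ _).trans (le_trans ?_ (le_abs_self _))
          refine Finset.sum_le_sum fun α hα => norm_deriv_cutoff_term_le hM ?_ ?_ (hL α hα x)
            (hL0 α hα)
          · exact Finset.prod_nonneg fun _ _ => Real.smoothTransition.nonneg _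
          · exact Finset.prod_le_one (fun _ _ => Real.smoothTransition.nonneg _)
              fun _ _ => Real.smoothTransition.le_one _
        · simp [hKψ x hx]
    -- At a fixed point of `Ω₊` the cutoff is eventually `1` and its derivative eventually `0`.
    · filter_upwards [hpos] with x hx
      refine tendsto_const_nhds.congr' ?_
      filter_upwards [eventually_two_lt hx] with n hn
      rw [sum_partialDeriv_wallCutoff_mul fun i => (hψ i).differentiable, hone hn,
        Complex.ofReal_one, one_mul]
      refine congrArg (f x * ·) (left_eq_add.2 (Finset.sum_eq_zero fun α hα => ?_))
      rw [deriv_smoothTransition_eq_zero fun h => by linarith [h.2, hn α hα]]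
      simp
  have hlim2 : Filter.Tendsto (fun n : ℕ =>
      ∫ x in Ωp, ∑ i, f' i x * ((wallCutoff A n x : ℂ) * ψ i x))
      Filter.atTop (nhds (∫ x in Ωp, ∑ i, f' i x * ψ i x)) := by
    refine tendsto_integral_of_dominated_convergence (fun x => ∑ i, ‖f' i x * ψ i x‖)
      (fun n => ?_) ?_ (fun n => ?_) ?_
    · exact (integrable_finsetSum _ fun i _ => integrable_mul_of_hasCompactSupport (hf' i)
        (htest n i).continuous (htest n i).2.1).aestronglyMeasurable
    · exact integrable_finsetSum _ fun i _ => (integrable_mul_of_hasCompactSupport (hf' i)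
        (hψ i).continuous (hψ i).2.1).norm
    · refine Filter.Eventually.of_forall fun x => (norm_sum_le _ _).trans ?_
      refine Finset.sum_le_sum fun i _ => ?_
      rw [norm_mul, norm_mul, norm_mul, Complex.norm_real,
        Real.norm_of_nonneg (wallCutoff_nonneg A n x)]
      gcongr
      exact mul_le_of_le_one_left (norm_nonneg _) (wallCutoff_le_one A n x)
    · filter_upwards [hpos] with x hx
      refine tendsto_const_nhds.congr' ?_
      filter_upwards [eventually_two_lt hx] with n hn
      simp [hone hn]
  simp_rw [hident] at hlim1
  exact tendsto_nhds_unique hlim1 hlim2.neg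

end ReflExt

namespace ReflExt

variable {d : ℕ} {R : Set (Eucl d)} {v : Eucl d} {Ω U : Set (Eucl d)}

/-! ### Weak derivatives and `H¹` -/

theorem partialDeriv_sum_const_mul {ι : Type*} (s : Finset ι) (c : ι → ℂ) {φ : ι → Eucl d → ℂ}
    (hφ : ∀ k, Differentiable ℝ (φ k)) (j : Fin d) (x : Eucl d) :
    partialDeriv j (fun y => ∑ k ∈ s, c k * φ k y) x = ∑ k ∈ s, c k * partialDeriv j (φ k) x := by
  unfold partialDeriv
  have h : HasFDerivAt (fun y => ∑ k ∈ s, c k * φ k y) (∑ k ∈ s, c k • fderiv ℝ (φ k) x) x :=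
    HasFDerivAt.fun_sum fun k _ => (hφ k x).hasFDerivAt.const_mul (c k)
  rw [h.fderiv]
  simp

theorem setIntegral_mul_test {f φ : Eucl d → ℂ} (hφ : IsTestFunction U φ) :
    ∫ x in U, f x * φ x = ∫ x, f x * φ x :=
  setIntegral_eq_integral_of_forall_compl_eq_zero fun x hx => by
    rw [hφ.eq_zero_of_notMem hx, mul_zero]

theorem HasWeakPartial.mono {f h : Eucl d → ℂ} {j : Fin d} (hw : HasWeakPartial Ω j f h)
    (hU : U ⊆ Ω) : HasWeakPartial U j f h where
  locallyIntegrable := hw.locallyIntegrable.mono_set hU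
  locallyIntegrable_deriv := hw.locallyIntegrable_deriv.mono_set hU
  integral_eq φ hφ := by
    have hφ' := hφ.mono hU
    rw [setIntegral_mul_test (hφ.partialDeriv j), setIntegral_mul_test hφ,
      ← setIntegral_mul_test (hφ'.partialDeriv j), ← setIntegral_mul_test hφ',
      hw.integral_eq φ hφ']

/-- Real test functions suffice to separate locally integrable functions. This transfers the `L²`
bound to any other choice of weak derivative. -/
theorem HasWeakPartial.ae_eq (hU : IsOpen U) {f h₁ h₂ : Eucl d → ℂ} {j : Fin d}
    (hw₁ : HasWeakPartial U j f h₁) (hw₂ : HasWeakPartial U j f h₂) :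
    h₁ =ᵐ[volume.restrict U] h₂ := by
  have hloc := hw₁.locallyIntegrable_deriv.sub hw₂.locallyIntegrable_deriv
  have := hU.ae_eq_zero_of_integral_contDiff_smul_eq_zero hloc fun g hg hgc hgs => by
    have htest : IsTestFunction U fun x => (g x : ℂ) :=
      ⟨Complex.ofRealCLM.contDiff.comp hg, hgc.comp_left (g := fun t : ℝ => (t : ℂ)) rfl,
        (closure_mono (Function.support_comp_subset (g := fun t : ℝ => (t : ℂ)) rfl g)).trans hgs⟩
    have hint : ∀ {h : Eucl d → ℂ}, LocallyIntegrableOn h U volume →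
        Integrable fun x => g x • h x := fun {h} hh => by
      change Integrable (g • h)
      rw [← integrableOn_iff_integrable_of_support_subset (s := tsupport g)
        ((Function.support_smul_subset_left g h).trans (subset_tsupport g))]
      exact (hh.integrableOn_compact_subset hgs hgc).continuousOn_smul
        hg.continuous.continuousOn hgc
    have heq : ∀ h : Eucl d → ℂ, ∫ x, g x • h x = ∫ x in U, h x * (g x : ℂ) := fun h => by
      rw [setIntegral_mul_test htest]
      simp_rw [Complex.real_smul, mul_comm]
    simp only [Pi.sub_apply, smul_sub]
    rw [integral_sub (hint hw₁.locallyIntegrable_deriv) (hint hw₂.locallyIntegrable_deriv),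
      heq, heq, sub_eq_zero, ← neg_inj, ← hw₁.integral_eq _ htest, ← hw₂.integral_eq _ htest]
  rw [Filter.EventuallyEq, ae_restrict_iff' hU.measurableSet]
  filter_upwards [this] with x hx hxU
  exact sub_eq_zero.1 (hx hxU)

theorem H1_mono {f : Eucl d → ℂ} (hf : f ∈ H1 Ω) (hU : U ⊆ Ω) : f ∈ H1 U := by
  refine ⟨hf.1.mono_measure (Measure.restrict_mono_set _ hU), fun j => ?_⟩
  obtain ⟨h, hh, hw⟩ := hf.2 j
  exact ⟨h, hh.mono_measure (Measure.restrict_mono_set _ hU), hw.mono hU⟩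

theorem H1_congr (hU : MeasurableSet U) {f F : Eucl d → ℂ} (hF : F ∈ H1 U)
    (h : Set.EqOn f F U) : f ∈ H1 U := by
  have hae : f =ᵐ[volume.restrict U] F := by
    filter_upwards [ae_restrict_mem hU] with x hx using h hx
  have hf := hF.1.ae_eq hae.symm
  refine ⟨hf, fun j => ?_⟩
  obtain ⟨h', hh, hw⟩ := hF.2 j
  refine ⟨h', hh, locallyIntegrableOn_of_memLp hf, hw.locallyIntegrable_deriv, fun φ hφ => ?_⟩
  rw [← hw.integral_eq φ hφ]
  exact setIntegral_congr_fun hU fun x hx => by simp only [h hx]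

theorem memLp_const_mul_sum {ι : Type*} (s : Finset ι) (c : ℂ) {f : ι → Eucl d → ℂ}
    {μ : Measure (Eucl d)} (hf : ∀ k, MemLp (f k) 2 μ) :
    MemLp (fun y => c * ∑ k ∈ s, f k y) 2 μ :=
  (memLp_finsetSum s fun k _ => hf k).const_mul c

theorem integral_const_mul_sum_mul {ι : Type*} (s : Finset ι) (c : ℂ) {f : ι → Eucl d → ℂ}
    (hf : ∀ k, MemLp (f k) 2 (volume.restrict U)) {φ : Eucl d → ℂ} (hφ : IsTestFunction U φ) :
    ∫ x in U, (c * ∑ k ∈ s, f k x) * φ x = c * ∑ k ∈ s, ∫ x in U, f k x * φ x := by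
  simp_rw [mul_assoc, Finset.sum_mul]
  rw [integral_const_mul, integral_finsetSum _ fun k _ =>
    integrable_mul_of_hasCompactSupport (hf k) hφ.continuous hφ.2.1]

theorem H1_const_mul_sum {ι : Type*} (s : Finset ι) (c : ℂ) {f : ι → Eucl d → ℂ}
    (hf : ∀ k, f k ∈ H1 U) : (fun y => c * ∑ k ∈ s, f k y) ∈ H1 U := by
  have h0 := memLp_const_mul_sum s c fun k => (hf k).1
  refine ⟨h0, fun j => ?_⟩
  choose h hh hw using fun k => (hf k).2 j
  have h1 := memLp_const_mul_sum s c hh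
  refine ⟨_, h1, locallyIntegrableOn_of_memLp h0, locallyIntegrableOn_of_memLp h1, fun φ hφ => ?_⟩
  rw [integral_const_mul_sum_mul s c (fun k => (hf k).1) (hφ.partialDeriv j),
    integral_const_mul_sum_mul s c hh hφ, ← mul_neg, ← Finset.sum_neg_distrib]
  simp_rw [fun k => (hw k).integral_eq φ hφ]

theorem eq_sum_smul_single (x : Eucl d) : x = ∑ k, x k • EuclideanSpace.single k (1 : ℝ) := by
  ext k
  simp [Pi.single_apply]

/-- The chain rule by duality: the isometry is moved onto the test function by a change of
variables, with `∂_j φ` written through the partials of `φ ∘ g⁻¹` in the direction `g e_j`. -/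
theorem H1_comp_isometry (hΩ : IsOpen Ω) (g : Eucl d ≃ₗᵢ[ℝ] Eucl d) (hg : g ⁻¹' Ω = Ω)
    {f : Eucl d → ℂ} (hf : f ∈ H1 Ω) : (fun x => f (g x)) ∈ H1 Ω := by
  have hmp : MeasurePreserving g (volume.restrict Ω) (volume.restrict Ω) := by
    have := g.measurePreserving.restrict_preimage hΩ.measurableSet
    rwa [hg] at this
  have hgs : g.symm ⁻¹' Ω ⊆ Ω := fun x hx => by
    rw [← hg] at hx
    simpa using hx
  have h0 : MemLp (fun x => f (g x)) 2 (volume.restrict Ω) := hf.1.comp_measurePreserving hmp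
  refine ⟨h0, fun j => ?_⟩
  choose h hh hw using hf.2
  set e : Eucl d := g (EuclideanSpace.single j 1) with he
  have h1 : MemLp (fun x => ∑ k, (e k : ℂ) * h k (g x)) 2 (volume.restrict Ω) :=
    memLp_finsetSum _ fun k _ => ((hh k).comp_measurePreserving hmp).const_mul _
  refine ⟨_, h1, locallyIntegrableOn_of_memLp h0, locallyIntegrableOn_of_memLp h1, fun φ hφ => ?_⟩
  have hφg : IsTestFunction Ω fun y => φ (g.symm y) := hφ.comp_isometry g.symm hgs
  have hpd : ∀ x, partialDeriv j φ x =
      ∑ k, (e k : ℂ) * partialDeriv k (fun y => φ (g.symm y)) (g x) := fun x => by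
    simp_rw [partialDeriv_comp_isometry hφ.differentiable, g.symm_apply_apply,
      ← Complex.real_smul, ← map_smul, ← map_sum, ← eq_sum_smul_single e, he, g.symm_apply_apply]
    rfl
  have hint : ∀ F : Eucl d → ℂ, ∫ x in Ω, F (g x) = ∫ x in Ω, F x := fun F =>
    hmp.integral_comp g.toHomeomorph.measurableEmbedding F
  simp_rw [hpd]
  rw [hint fun y => f y * ∑ k, (e k : ℂ) * partialDeriv k (fun y => φ (g.symm y)) y]
  have hφ' : ∀ x, (∑ k, (e k : ℂ) * h k (g x)) * φ x =
      (fun y => (∑ k, (e k : ℂ) * h k y) * φ (g.symm y)) (g x) := fun x => by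
    simp only [g.symm_apply_apply]
  rw [integral_congr_ae (Filter.Eventually.of_forall hφ'),
    hint fun y => (∑ k, (e k : ℂ) * h k y) * φ (g.symm y)]
  simp_rw [Finset.mul_sum, Finset.sum_mul, mul_left_comm (f _), mul_assoc]
  rw [integral_finsetSum _ fun k _ => (integrable_mul_of_hasCompactSupport hf.1
      (hφg.partialDeriv k).continuous (hφg.partialDeriv k).2.1).const_mul _,
    integral_finsetSum _ fun k _ => (integrable_mul_of_hasCompactSupport (hh k)
      hφg.continuous hφg.2.1).const_mul _, ← Finset.sum_neg_distrib]
  refine Finset.sum_congr rfl fun k _ => ?_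
  rw [integral_const_mul, integral_const_mul, (hw k).integral_eq _ hφg, mul_neg]

/-! ### Symmetric sets -/

theorem IsSymmetricSet.apply_mem (hs : IsSymmetricSet R Ω) {g : Eucl d ≃ₗᵢ[ℝ] Eucl d}
    (hg : g ∈ reflGroup R) : ∀ x ∈ Ω, g x ∈ Ω := by
  have hrefl : ∀ β ∈ R, ∀ x ∈ Ω, rootRefl β x ∈ Ω := fun β hβ x hx => by
    rw [← hs β hβ]
    exact ⟨x, hx, rfl⟩
  induction hg using Subgroup.closure_induction'' with
  | mem x hx =>
    obtain ⟨β, hβ, rfl⟩ := hx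
    exact hrefl β hβ
  | inv_mem x hx =>
    obtain ⟨β, hβ, rfl⟩ := hx
    rw [inv_eq_of_mul_eq_one_left (rootRefl_mul_self β)]
    exact hrefl β hβ
  | one => exact fun x hx => hx
  | mul x y _ _ hx hy => exact fun z hz => hx _ (hy _ hz)

theorem IsSymmetricSet.preimage_eq (hs : IsSymmetricSet R Ω) (g : reflGroup R) :
    g.1 ⁻¹' Ω = Ω := by
  refine Set.Subset.antisymm (fun x hx => ?_) (hs.apply_mem g.2)
  have := hs.apply_mem (g⁻¹).2 _ hx
  rwa [show (g⁻¹).1 (g.1 x) = x from g.1.symm_apply_apply x] at this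

theorem IsNormalizedRootSystem.finite_posRoots (hR : IsNormalizedRootSystem R) :
    (posRoots R v).Finite :=
  hR.finite.subset fun _ h => h.1

theorem posRegion_eq (hR : IsNormalizedRootSystem R) :
    posRegion R v Ω =
      Ω ∩ {x | ∀ α ∈ (hR.finite_posRoots (v := v)).toFinset, 0 < inner ℝ α x} := by
  ext x
  simp [posRegion, posChamber, real_inner_comm]

theorem isOpen_posRegion (hR : IsNormalizedRootSystem R) (hΩ : IsOpen Ω) :
    IsOpen (posRegion R v Ω) := by
  rw [posRegion_eq hR]
  refine hΩ.inter ?_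
  simp only [Set.ofPred_forall]
  exact isOpen_biInter_finset fun α _ => isOpen_lt continuous_const (by fun_prop)

/-! ### The extension operators -/

theorem memLp_weightedExtension (hR : IsNormalizedRootSystem R) (hU : MeasurableSet U)
    (ω : reflGroup R → ℂ) {φ : Eucl d → ℂ} (hφ : MemLp φ 2 (volume.restrict U)) :
    MemLp (weightedExtension R U ω φ) 2 volume := by
  have := finite_reflGroup hR
  have := Fintype.ofFinite (reflGroup R)
  unfold weightedExtension
  simp_rw [finsum_eq_sum_of_fintype]
  refine memLp_finsetSum _ fun g _ => MemLp.const_mul ?_ _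
  exact ((memLp_indicator_iff_restrict hU).2 hφ).comp_measurePreserving g.1.symm.measurePreserving

/-- Substitute `y = g x` in each term of the sum; no disjointness of the translates is needed. -/
theorem integral_weightedExtension_mul [Fintype (reflGroup R)] (hU : MeasurableSet U)
    (ω : reflGroup R → ℂ) {φ : Eucl d → ℂ} (hφ : MemLp φ 2 (volume.restrict U))
    {u : Eucl d → ℂ} (hu : Continuous u) (hc : HasCompactSupport u) :
    ∫ y, weightedExtension R U ω φ y * u y =
      ∫ x in U, φ x * ∑ g : reflGroup R, ω g * u (g.1 x) := by
  have hint : ∀ g : reflGroup R, Integrable (fun x => φ x * (ω g * u (g.1 x)))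
      (volume.restrict U) := fun g =>
    integrable_mul_of_hasCompactSupport hφ (continuous_const.mul (hu.comp g.1.continuous))
      (hc.comp_homeomorph g.1.toHomeomorph).mul_left
  have hfun : ∀ g : reflGroup R, ∀ x, U.indicator (fun x => φ x * (ω g * u (g.1 x))) x =
      (fun y => ω g * U.indicator φ (g.1.symm y) * u y) (g.1 x) := fun g x => by
    simp only [LinearIsometryEquiv.symm_apply_apply]
    by_cases hx : x ∈ U
    · simp only [Set.indicator_of_mem hx]; ring
    · simp [Set.indicator_of_notMem hx]
  unfold weightedExtension
  simp_rw [finsum_eq_sum_of_fintype, Finset.sum_mul, Finset.mul_sum]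
  rw [integral_finsetSum _ fun g _ => hint g, integral_finsetSum]
  · refine Finset.sum_congr rfl fun g _ => ?_
    rw [← integral_indicator hU, funext (hfun g),
      g.1.measurePreserving.integral_comp g.1.toHomeomorph.measurableEmbedding]
  · intro g _
    have hi := (integrable_indicator_iff hU).2 (hint g)
    rw [funext (hfun g)] at hi
    exact (g.1.measurePreserving.integrable_comp_emb
      g.1.toHomeomorph.measurableEmbedding).1 hi

/-- The field `∑_g φ(g x) g⁻¹ e_j` associated with the test function `φ`. -/
noncomputable def symmetrizedField (R : Set (Eucl d)) [Fintype (reflGroup R)] (j : Fin d)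
    (φ : Eucl d → ℂ) (i : Fin d) (x : Eucl d) : ℂ :=
  ∑ g : reflGroup R, entryWeight R j i g * φ (g.1 x)

section symmetrizedField

variable [Fintype (reflGroup R)] {φ : Eucl d → ℂ}

theorem isTestFunction_symmetrizedField (hs : IsSymmetricSet R Ω) (hφ : IsTestFunction Ω φ)
    (j i : Fin d) : IsTestFunction Ω (symmetrizedField R j φ i) :=
  IsTestFunction.sum _ fun g _ => (hφ.comp_isometry g.1 (hs.preimage_eq g).le).const_mul _

/-- The `g`-th term of the field points along `g⁻¹e_j`, and the chain rule for `φ(g ·)` turns this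
direction back into `e_j`. -/
theorem divergence_symmetrizedField (hφ : Differentiable ℝ φ) (j : Fin d) (x : Eucl d) :
    ∑ i, partialDeriv i (symmetrizedField R j φ i) x =
      ∑ g : reflGroup R, partialDeriv j φ (g.1 x) := by
  unfold symmetrizedField
  simp_rw [fun i => partialDeriv_sum_const_mul Finset.univ (entryWeight R j i)
    (φ := fun (g : reflGroup R) y => φ (g.1 y)) (fun g => hφ.comp g.1.differentiable) i x,
    partialDeriv_comp_isometry hφ]
  rw [Finset.sum_comm]
  refine Finset.sum_congr rfl fun g _ => ?_
  -- Orthogonality: `g⁻¹` is the transpose, so `g⁻¹e_j` is the `j`-th row of `g`.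
  have hcol : g.1.symm (EuclideanSpace.single j 1) =
      ∑ i, (g.1 (EuclideanSpace.single i 1) j) • EuclideanSpace.single i (1 : ℝ) := by
    rw [eq_sum_smul_single (g.1.symm (EuclideanSpace.single j 1))]
    refine Finset.sum_congr rfl fun i _ => ?_
    congr 1
    have h := g.1.inner_map_map (EuclideanSpace.single i 1) (g.1.symm (EuclideanSpace.single j 1))
    rw [g.1.apply_symm_apply] at h
    simpa [EuclideanSpace.inner_single_left, EuclideanSpace.inner_single_right] using h.symm
  simp_rw [entryWeight, ← Complex.real_smul, ← map_smul, ← map_sum, ← hcol,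
    g.1.apply_symm_apply]
  rfl

theorem sum_mul_symmetrizedField (j : Fin d) (α x : Eucl d) :
    ∑ i, (α i : ℂ) * symmetrizedField R j φ i x =
      ∑ g : reflGroup R, ((g.1 α j : ℝ) : ℂ) * φ (g.1 x) := by
  simp_rw [symmetrizedField, Finset.mul_sum, apply_eq_sum_entry, Finset.sum_mul]
  rw [Finset.sum_comm]
  exact Finset.sum_congr rfl fun g _ => Finset.sum_congr rfl fun i _ => by ring

theorem symmetrizedField_tangential (hR : IsNormalizedRootSystem R) (hs : IsSymmetricSet R Ω)
    (hφ : IsTestFunction Ω φ) (j : Fin d) {α : Eucl d} (hα : α ∈ R) :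
    ∃ L : ℝ, 0 ≤ L ∧
      ∀ x, ‖∑ i, (α i : ℂ) * symmetrizedField R j φ i x‖ ≤ L * |inner ℝ α x| := by
  have hnorm := hR.norm_eq_one α hα
  set Θ : Eucl d → ℂ := fun x => ∑ i, (α i : ℂ) * symmetrizedField R j φ i x with hΘ
  have htest : IsTestFunction Ω Θ := IsTestFunction.sum _ fun i _ =>
    (isTestFunction_symmetrizedField hs hφ j i).const_mul _
  obtain ⟨L, hL⟩ := htest.1.lipschitzWith_of_hasCompactSupport htest.2.1 (by simp)
  have hodd : ∀ x, Θ (rootRefl α x) = -Θ x := fun x => by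
    simp only [hΘ, sum_mul_symmetrizedField]
    rw [← Finset.sum_neg_distrib]
    let s : reflGroup R := ⟨rootRefl α, Subgroup.subset_closure ⟨α, hα, rfl⟩⟩
    -- Right translation by `σ_α` fixes the sum but changes `g α` into `-g α`.
    refine Fintype.sum_equiv (Equiv.mulRight s) _ _ fun g => ?_
    have h1 : (Equiv.mulRight s g).1 α = -g.1 α := by
      change g.1 (rootRefl α α) = _
      rw [rootRefl_self hnorm, map_neg]
    have h2 : (Equiv.mulRight s g).1 x = g.1 (rootRefl α x) := rfl
    rw [h1, h2]
    simp
  refine ⟨L, L.2, fun x => ?_⟩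
  -- By oddness the left side is `2‖Θ x‖`, and the distance from `x` to its mirror image is `2|⟨α,
  -- x⟩|`.
  have h := hL.dist_le_mul x (rootRefl α x)
  rw [dist_eq_norm, dist_eq_norm, hodd, rootRefl_apply hnorm, sub_neg_eq_add, ← two_mul,
    sub_sub_cancel, norm_mul, norm_smul, hnorm, Real.norm_eq_abs, abs_mul] at h
  norm_num at h
  change ‖Θ x‖ ≤ _
  linarith

end symmetrizedField

theorem hasWeakPartial_weightedExtension (hR : IsNormalizedRootSystem R) (hΩ : IsOpen Ω)
    (hs : IsSymmetricSet R Ω) {f : Eucl d → ℂ} {f' : Fin d → Eucl d → ℂ}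
    (hf : MemLp f 2 (volume.restrict (posRegion R v Ω)))
    (hf' : ∀ i, MemLp (f' i) 2 (volume.restrict (posRegion R v Ω)))
    (hw : ∀ i, HasWeakPartial (posRegion R v Ω) i f (f' i)) (j : Fin d) :
    HasWeakPartial Ω j (weightedExtension R (posRegion R v Ω) 1 f)
      (∑ i, weightedExtension R (posRegion R v Ω) (entryWeight R j i) (f' i)) := by
  have hm := (isOpen_posRegion (v := v) hR hΩ).measurableSet
  have hext := memLp_weightedExtension hR hm 1 hf
  have hext' := fun i => memLp_weightedExtension hR hm (entryWeight R j i) (hf' i)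
  refine ⟨locallyIntegrableOn_of_memLp (hext.restrict _),
    locallyIntegrableOn_of_memLp (memLp_finsetSum' _ fun i _ => (hext' i).restrict _), fun φ hφ => ?_⟩
  have := finite_reflGroup hR
  have := Fintype.ofFinite (reflGroup R)
  have hψ := isTestFunction_symmetrizedField hs hφ j
  have hparts := integral_mul_divergence_of_tangential hΩ (posRegion_eq hR) hf hf' hw hψ
    fun α hα => symmetrizedField_tangential hR hs hφ j ((Set.Finite.mem_toFinset _).1 hα).1
  simp_rw [divergence_symmetrizedField hφ.differentiable] at hparts
  rw [setIntegral_mul_test (hφ.partialDeriv j), setIntegral_mul_test hφ,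
    integral_weightedExtension_mul hm 1 hf (hφ.partialDeriv j).continuous (hφ.partialDeriv j).2.1]
  simp_rw [Pi.one_apply, one_mul, hparts, Finset.sum_apply, Finset.sum_mul]
  rw [integral_finsetSum, integral_finsetSum]
  · simp_rw [fun i => integral_weightedExtension_mul hm (entryWeight R j i) (hf' i)
      hφ.continuous hφ.2.1]
    rfl
  · intro i _
    have h := (hext' i).restrict Set.univ
    simpa only [Measure.restrict_univ] using
      integrable_mul_of_hasCompactSupport h hφ.continuous hφ.2.1
  · exact fun i _ => integrable_mul_of_hasCompactSupport (hf' i) (hψ i).continuous (hψ i).2.1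

theorem weightedExtension_mem_H1 (hR : IsNormalizedRootSystem R) (hΩ : IsOpen Ω)
    (hs : IsSymmetricSet R Ω) {f : Eucl d → ℂ} (hf : f ∈ H1 (posRegion R v Ω)) :
    weightedExtension R (posRegion R v Ω) 1 f ∈ H1 Ω := by
  have hm := (isOpen_posRegion (v := v) hR hΩ).measurableSet
  choose h hh hw using hf.2
  exact ⟨(memLp_weightedExtension hR hm 1 hf.1).restrict _, fun j =>
    ⟨_, memLp_finsetSum' _ fun i _ => (memLp_weightedExtension hR hm _ (hh i)).restrict _,
      hasWeakPartial_weightedExtension hR hΩ hs hf.1 hh hw j⟩⟩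

theorem weightedAverage_mem_H1 (hR : IsNormalizedRootSystem R) (hΩ : IsOpen Ω)
    (hs : IsSymmetricSet R Ω) {F : Eucl d → ℂ} (hF : F ∈ H1 Ω) :
    weightedAverage R 1 F ∈ H1 Ω := by
  have := finite_reflGroup hR
  have := Fintype.ofFinite (reflGroup R)
  unfold weightedAverage
  simp_rw [finsum_eq_sum_of_fintype, Pi.one_apply, one_mul]
  exact H1_const_mul_sum _ _ fun g : reflGroup R =>
    H1_comp_isometry hΩ g.1 (hs.preimage_eq g) hF

/-- The extension takes the value `f x` at each `g x`, so the average over the orbit is again `f x`.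
-/
theorem weightedAverage_weightedExtension (hR : IsNormalizedRootSystem R)
    (hv : ∀ α ∈ R, inner ℝ α v ≠ 0) (f : Eucl d → ℂ) {x : Eucl d} (hx : x ∈ posRegion R v Ω) :
    weightedAverage R 1 (weightedExtension R (posRegion R v Ω) 1 f) x = f x := by
  have := finite_reflGroup hR
  have := Fintype.ofFinite (reflGroup R)
  have hcard : (Nat.card (reflGroup R) : ℂ) ≠ 0 := by exact_mod_cast Nat.card_pos.ne'
  unfold weightedAverage
  simp_rw [fun g => weightedExtension_apply hR hv Ω 1 f g hx, finsum_eq_sum_of_fintype,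
    Pi.one_apply, one_mul, Finset.sum_const, Finset.card_univ, ← Nat.card_eq_fintype_card,
    nsmul_eq_mul]
  field_simp

end ReflExt

/-! ### The extension formula and the description of `H¹(Ω₊)`. -/

theorem proposition3p1 {d : ℕ} (R : Set (Eucl d)) (hR : IsNormalizedRootSystem R)
    (v : Eucl d) (hv : ∀ α ∈ R, inner ℝ α v ≠ 0)
    (Ω : Set (Eucl d)) (hΩ : IsOpen Ω) (hsymm : IsSymmetricSet R Ω) :
    (∀ (ω : reflGroup R → ℂ) (φ : Eucl d → ℂ) (g : reflGroup R), ∀ x ∈ posRegion R v Ω,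
      weightedExtension R (posRegion R v Ω) ω φ (g.1 x) = ω g * φ x) ∧
    (∀ f ∈ H1 (posRegion R v Ω),
      weightedExtension R (posRegion R v Ω) 1 f ∈ H1 Ω ∧
      ∀ f' : Fin d → Eucl d → ℂ, (∀ i, HasWeakPartial (posRegion R v Ω) i f (f' i)) →
        ∀ j, HasWeakPartial Ω j (weightedExtension R (posRegion R v Ω) 1 f)
          (∑ i, weightedExtension R (posRegion R v Ω) (entryWeight R j i) (f' i))) ∧
    H1 (posRegion R v Ω) = restrictions (posRegion R v Ω) (weightedAverage R 1 '' H1 Ω) := by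
  have hopen := isOpen_posRegion (v := v) hR hΩ
  refine ⟨fun ω φ g x hx => weightedExtension_apply hR hv Ω ω φ g hx, fun f hf =>
    ⟨weightedExtension_mem_H1 hR hΩ hsymm hf, fun f' hw => ?_⟩, Set.Subset.antisymm ?_ ?_⟩
  · refine hasWeakPartial_weightedExtension hR hΩ hsymm hf.1 (fun i => ?_) hw
    -- The given `f'` is only known to be locally integrable; uniqueness of weak derivatives puts it
    -- in `L²`.
    obtain ⟨h, hh, hwh⟩ := hf.2 i
    exact hh.ae_eq (hwh.ae_eq hopen (hw i))
  · exact fun f hf => ⟨_, ⟨_, weightedExtension_mem_H1 hR hΩ hsymm hf, rfl⟩,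
      fun x hx => (weightedAverage_weightedExtension hR hv f hx).symm⟩
  · rintro f ⟨_, ⟨F, hF, rfl⟩, hEq⟩
    exact H1_congr hopen.measurableSet
      (H1_mono (weightedAverage_mem_H1 hR hΩ hsymm hF) Set.inter_subset_left) hEq
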